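/- In online bin covering, a sequence $I$ of items with sizes in $(0,1)$ arrives one item at a time, and each item has to be packed irrevocably into a bin; a bin is covered if the items packed in it have total size at least $1$. Let $A(I)$ be the number of bins covered by the algorithm $A$ on $I$, and let $\mathrm{Opt}(I)$ be the largest number of bins that can be covered with the items of $I$. Dual Next-Fit (DNF) packs each item into its single open bin (opening one if there is none) and closes that bin as soon as it is covered. For $k\ge 2$, the Dual Harmonic algorithm $\mathrm{DH}_k$ divides $(0,1)$ into the intervals $(0,\frac1k),[\frac1k,\frac1{k-1}),\dots,[\frac12,1)$ and packs the items of each interval in separate bins, using DNF within each interval; so every covered bin for $[\frac1j,\frac1{j-1})$ contains exactly $j$ items. For an algorithm $A$, define the asymptotic expected performance ratio $$\mathrm{ER}(A)=\lim_{n\to\infty}\frac{E[A(I_n)]}{E[\mathrm{Opt}(I_n)]},$$ where $I_n$ is a sequence of $n$ independent items, each uniformly distributed on $(0,1)$. **Theorem.** The limit $\mathrm{ER}(\mathrm{DH}_k)$ exists for every $k\ge2$, and $$\mathrm{ER}(\mathrm{DH}_2)=\frac12+\frac1{e^2-e}\approx 0.7141,\qquad \lim_{k\to\infty}\mathrm{ER}(\mathrm{DH}_k)=\frac{12-\pi^2}{3}\approx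 0.7101,$$ where the decimals are correct to within $5\cdot10^{-5}$. Moreover, $\mathrm{ER}(\mathrm{DNF})$ exists and equals $\frac2e$, and both values above are smaller than $\frac2e$. -/

import Mathlib

open MeasureTheory Filter Topology

noncomputable section

namespace BinCovering

/-- One step of an online bin covering algorithm that sorts the items into types by `c`, packs
items of different types into different bins, and keeps at most one open bin per type.
A state consists of the level (total size) of the open bin of each type, with level `0` if that
type has no open bin, and of the number of bins covered so far. A new item is packed into the
open bin of its type (a newly opened one if there is none), and this bin is closed as soon as its
level is at least `1`. -/
def step (c : ℝ → ℕ) (s : (ℕ → ℝ) × ℕ) (x : ℝ) : (ℕ → ℝ) × ℕ :=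
  if 1 ≤ s.1 (c x) + x then (Function.update s.1 (c x) 0, s.2 + 1)
  else (Function.update s.1 (c x) (s.1 (c x) + x), s.2)

/-- The number of bins covered on the sequence `I` by the algorithm with type map `c`. -/
def covered (c : ℝ → ℕ) (I : List ℝ) : ℕ :=
  (I.foldl (step c) (fun _ => 0, 0)).2

/-- Dual Next-Fit: all items have the same type. -/
def DNF (I : List ℝ) : ℕ := covered (fun _ => 0) I

/-- The Dual Harmonic type of an item size `x ∈ (0,1)`: the type is `j` if `1/j ≤ x < 1/(j-1)`
with `2 ≤ j ≤ k`, and it is `k + 1` if `0 < x < 1/k`. See `harmonicType_eq_iff` and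
`harmonicType_eq_succ_iff`. -/
def harmonicType (k : ℕ) (x : ℝ) : ℕ := min ⌈1 / x⌉₊ (k + 1)

theorem harmonicType_eq_iff {k j : ℕ} (hj : 2 ≤ j) (hjk : j ≤ k) {x : ℝ} (hx : 0 < x) :
    harmonicType k x = j ↔ x ∈ Set.Ico (1 / (j : ℝ)) (1 / ((j : ℝ) - 1)) := by
  have h1 : harmonicType k x = j ↔ ⌈1 / x⌉₊ = j := by
    unfold harmonicType; omega
  have hj' : (2 : ℝ) ≤ j := by exact_mod_cast hj
  rw [h1, Nat.ceil_eq_iff (by omega), Nat.cast_sub (by omega), Nat.cast_one, Set.mem_Ico,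
    lt_one_div (by linarith) hx, one_div_le hx (by linarith)]
  tauto

theorem harmonicType_eq_succ_iff {k : ℕ} (hk : 2 ≤ k) {x : ℝ} (hx : 0 < x) :
    harmonicType k x = k + 1 ↔ x < 1 / (k : ℝ) := by
  have h1 : harmonicType k x = k + 1 ↔ k < ⌈1 / x⌉₊ := by
    unfold harmonicType; omega
  have hk' : (2 : ℝ) ≤ k := by exact_mod_cast hk
  rw [h1, Nat.lt_ceil, lt_one_div (by linarith) hx]

/-- Dual Harmonic with parameter `k`. Since `j` items of sizes in `[1/j, 1/(j-1))` have total size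
at least `1`, and `j - 1` of them have total size less than `1`, each covered bin of type `j ≤ k`
holds exactly `j` items. -/
def DH (k : ℕ) (I : List ℝ) : ℕ := covered (harmonicType k) I

/-- The largest number of bins that can be covered by the items `x 0, …, x (n-1)`: the maximum,
over all ways `f` of packing the `n` items into `n` bins, of the number of covered bins. -/
def opt {n : ℕ} (x : Fin n → ℝ) : ℕ :=
  Finset.univ.sup fun f : Fin n → Fin n =>
    (Finset.univ.filter fun b : Fin n => 1 ≤ ∑ i with f i = b, x i).card

/-- The law of a sequence of `n` independent items, each uniformly distributed on `(0,1)`. -/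
def uniformItems (n : ℕ) : Measure (Fin n → ℝ) :=
  Measure.pi fun _ => volume.restrict (Set.Ioo (0 : ℝ) 1)

/-- The expected performance ratio of the algorithm `A` under the uniform distribution exists and
equals `r`: the expectations `E[A(I)]` and `E[Opt(I)]` over `n` i.i.d. uniform items are well
defined, and their ratio tends to `r` as `n → ∞`. -/
def HasExpectedRatio (A : List ℝ → ℕ) (r : ℝ) : Prop :=
  (∀ n, Integrable (fun x : Fin n → ℝ => (A (List.ofFn x) : ℝ)) (uniformItems n)) ∧
  (∀ n, Integrable (fun x : Fin n → ℝ => (opt x : ℝ)) (uniformItems n)) ∧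
  Tendsto (fun n : ℕ =>
      (∫ x : Fin n → ℝ, (A (List.ofFn x) : ℝ) ∂uniformItems n) /
        (∫ x : Fin n → ℝ, (opt x : ℝ) ∂uniformItems n))
    atTop (𝓝 r)

end BinCovering

end

/-! Both algorithms follow one scheme: harmonic types for sizes at least `1/k`, Next-Fit for the
rest; Dual Next-Fit is the case `k = 1`. For fixed `k`, a potential is attached to the run: the
number of covered bins plus a bounded credit for the open bins, chosen so that each new item raises
it by the same expected amount `coverRate k`, whatever the current state (`step_admissible`,
`integral_increment`). Hence the expected number of covered bins is `n * coverRate k + O(1)`.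

An item of type `j ≤ k` contributes `1/j`. For the small items, let `m(u)` be the mean number of
uniform summands needed to reach `u`. After scaling by `k`, a bin at level `l` still awaits
`m(k(1-l))` small items on average, so its credit is `1 - m(k(1-l))/m(k)`; the renewal equation
`m(T) = 1 + ∫_{T-1}^T m` turns the expected gain into `1/(k m(k))`. The proof works with an explicit
formula for `m` and needs only this equation, positivity and the values `m(1) = e`, `m(2) = e² - e`;
the limit in `k` uses `m ≥ 1` and `∑ 1/j² = π²/6`.

The expected optimum is asymptotic to `n/2`: it is at most the expected total size, and pairing
items of sizes about `y` and `1 - y` covers nearly `n/2` bins (`le_integral_opt`). The ratio is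
therefore `2 * coverRate k`. -/

namespace BinCovering

/-! ### The renewal function of uniform summands -/

/-- The `j`-th term of the expected number of uniform summands on `(0,1)` needed to reach `u`. -/
noncomputable def renewalTerm (j : ℕ) : ℝ → ℝ :=
  (Set.Ioi (j : ℝ)).indicator fun u => (-1) ^ j * (u - j) ^ j / (j.factorial : ℝ) * Real.exp (u - j)

/-- The expected number of independent uniform summands on `(0,1)` needed to reach a total of at
least `u`, for `u ≤ k`. -/
noncomputable def renewal (k : ℕ) (u : ℝ) : ℝ := ∑ j ∈ Finset.range k, renewalTerm j u

theorem renewalTerm_of_le {j : ℕ} {u : ℝ} (h : u ≤ j) : renewalTerm j u = 0 :=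
  Set.indicator_of_notMem (by simpa using h) _

theorem renewalTerm_of_lt {j : ℕ} {u : ℝ} (h : (j : ℝ) < u) :
    renewalTerm j u = (-1) ^ j * (u - j) ^ j / (j.factorial : ℝ) * Real.exp (u - j) :=
  Set.indicator_of_mem (by simpa using h) _

theorem intervalIntegrable_renewalTerm (j : ℕ) (a b : ℝ) :
    IntervalIntegrable (renewalTerm j) volume a b := by
  have h : Continuous fun u : ℝ =>
      (-1) ^ j * (u - j) ^ j / (j.factorial : ℝ) * Real.exp (u - j) := by fun_prop
  exact intervalIntegrable_iff.2
    ((intervalIntegrable_iff.1 (h.intervalIntegrable a b)).indicator measurableSet_Ioi)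

theorem measurable_renewalTerm (j : ℕ) : Measurable (renewalTerm j) := by
  unfold renewalTerm
  exact Measurable.indicator (by fun_prop) measurableSet_Ioi

theorem measurable_renewal (k : ℕ) : Measurable (renewal k) :=
  Finset.measurable_fun_sum _ fun j _ => measurable_renewalTerm j

theorem intervalIntegrable_renewal (k : ℕ) (a b : ℝ) :
    IntervalIntegrable (renewal k) volume a b := by
  have h := IntervalIntegrable.sum (Finset.range k)
    (fun j _ => intervalIntegrable_renewalTerm j a b)
  refine h.congr (fun u _ => ?_)
  simp [renewal]

/-- The factor `(u - j)^j` vanishes at the cut-off `u = j` when `j ≥ 1`. Only the term `j = 0`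
jumps, at `0`. -/
theorem continuous_renewalTerm_succ (j : ℕ) : Continuous (renewalTerm (j + 1)) := by
  have h : renewalTerm (j + 1) = fun u : ℝ => (-1) ^ (j + 1) * (max (u - (j + 1 : ℕ)) 0) ^ (j + 1) /
      ((j + 1).factorial : ℝ) * Real.exp (u - (j + 1 : ℕ)) := by
    ext u
    rcases le_or_gt u (j + 1 : ℕ) with hu | hu
    · rw [renewalTerm_of_le hu, max_eq_right (by linarith)]; simp
    · rw [renewalTerm_of_lt hu, max_eq_left (by linarith)]
  rw [h]; fun_prop

/-- Termwise form of the delay equation `m'(u) = m(u) - m(u - 1)`: differentiating the power lowers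
`j` by one and shifts the argument. -/
theorem hasDerivAt_renewalTerm_succ (j : ℕ) {u : ℝ} (hu : u ≠ (j + 1 : ℕ)) :
    HasDerivAt (renewalTerm (j + 1)) (renewalTerm (j + 1) u - renewalTerm j (u - 1)) u := by
  rcases lt_or_gt_of_ne hu with hu | hu
  · rw [renewalTerm_of_le hu.le, renewalTerm_of_le (by push_cast at hu; linarith), sub_zero]
    refine (hasDerivAt_const u (0 : ℝ)).congr_of_eventuallyEq ?_
    filter_upwards [Iio_mem_nhds hu] with v hv
    exact renewalTerm_of_le (le_of_lt hv)
  · rw [renewalTerm_of_lt hu, renewalTerm_of_lt (by push_cast at hu; linarith)]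
    have hs : HasDerivAt (fun v : ℝ => v - (j + 1 : ℕ)) 1 u := (hasDerivAt_id u).sub_const _
    have := ((((hs.pow (j + 1)).const_mul ((-1) ^ (j + 1))).div_const
      ((j + 1).factorial : ℝ)).mul hs.exp)
    refine (this.congr_of_eventuallyEq ?_).congr_deriv ?_
    · filter_upwards [Ioi_mem_nhds hu] with v hv
      rw [renewalTerm_of_lt hv]
      rfl
    · have hf : (j.factorial : ℝ) ≠ 0 := by positivity
      have he : u - 1 - (j : ℝ) = u - (j + 1 : ℕ) := by push_cast; ring
      rw [he, Nat.factorial_succ]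
      simp only [Nat.add_sub_cancel, Pi.pow_apply]
      push_cast
      field_simp
      ring

theorem renewalTerm_succ_eq_integral (j : ℕ) {T : ℝ} (hT : 0 ≤ T) :
    renewalTerm (j + 1) T =
      (∫ u in (0 : ℝ)..T, renewalTerm (j + 1) u) - ∫ u in (-1)..(T - 1), renewalTerm j u := by
  have hi : IntervalIntegrable (fun u => renewalTerm j (u - 1)) volume 0 T := by
    simpa using (intervalIntegrable_renewalTerm j (0 - 1) (T - 1)).comp_sub_right 1
  -- Continuity suffices at the possible corner `u = j + 1`, so the fundamental theorem of calculus
  -- still applies.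
  have h := integral_eq_of_hasDerivAt_off_countable_of_le (renewalTerm (j + 1))
    (fun u => renewalTerm (j + 1) u - renewalTerm j (u - 1)) hT
    (Set.countable_singleton ((j + 1 : ℕ) : ℝ)) (continuous_renewalTerm_succ j).continuousOn
    (fun u hu => hasDerivAt_renewalTerm_succ j (by simpa using hu.2))
    ((intervalIntegrable_renewalTerm (j + 1) 0 T).sub hi)
  rw [renewalTerm_of_le (u := 0) (by positivity), sub_zero,
    intervalIntegral.integral_sub (intervalIntegrable_renewalTerm (j + 1) 0 T) hi,
    intervalIntegral.integral_comp_sub_right (fun u => renewalTerm j u), zero_sub] at h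
  exact h.symm

/-- The jump of this term at `0` supplies the constant `1` of the renewal equation. -/
theorem renewalTerm_zero_eq_integral {T : ℝ} (hT : 0 < T) :
    renewalTerm 0 T = 1 + ∫ u in (0 : ℝ)..T, renewalTerm 0 u := by
  have h : ∫ u in (0 : ℝ)..T, renewalTerm 0 u = ∫ u in (0 : ℝ)..T, Real.exp u := by
    rw [intervalIntegral.integral_of_le hT.le, intervalIntegral.integral_of_le hT.le]
    refine setIntegral_congr_fun measurableSet_Ioc fun u hu => ?_
    rw [renewalTerm_of_lt (by simpa using hu.1)]; simp
  rw [h, integral_exp, renewalTerm_of_lt (by simpa using hT)]; simp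

theorem renewal_of_nonpos (k : ℕ) {u : ℝ} (hu : u ≤ 0) : renewal k u = 0 :=
  Finset.sum_eq_zero fun j _ => renewalTerm_of_le (hu.trans (Nat.cast_nonneg j))

theorem renewal_succ_of_le {k : ℕ} {u : ℝ} (hu : u ≤ k) : renewal (k + 1) u = renewal k u := by
  rw [renewal, Finset.sum_range_succ, renewalTerm_of_le hu, add_zero, renewal]

theorem integral_renewal (k : ℕ) (a b : ℝ) :
    ∫ u in a..b, renewal k u = ∑ j ∈ Finset.range k, ∫ u in a..b, renewalTerm j u :=
  intervalIntegral.integral_finsetSum fun j _ => intervalIntegrable_renewalTerm j a b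

/-- The renewal equation. -/
theorem renewal_eq_integral {k : ℕ} {T : ℝ} (hT : 0 < T) (hTk : T ≤ k) :
    renewal k T = 1 + ∫ u in (T - 1)..T, renewal k u := by
  obtain ⟨k, rfl⟩ : ∃ m, k = m + 1 := ⟨k - 1, by
    have : (0 : ℝ) < k := hT.trans_le hTk
    have : 0 < k := by exact_mod_cast this
    omega⟩
  have h0 : ∫ u in (-1 : ℝ)..0, renewal (k + 1) u = 0 := by
    refine intervalIntegral.integral_zero_ae (ae_of_all _ fun u hu => ?_)
    rw [Set.uIoc_of_le (by norm_num)] at hu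
    exact renewal_of_nonpos _ hu.2
  -- The integrated delay equation pairs term `j + 1` with term `j`, so the shifted integral has one
  -- term fewer; that term vanishes up to `T - 1`.
  have h1 : ∫ u in (-1)..(T - 1), renewal (k + 1) u = ∫ u in (-1)..(T - 1), renewal k u := by
    refine intervalIntegral.integral_congr fun u hu => renewal_succ_of_le ?_
    rw [Set.uIcc_of_le (by linarith)] at hu
    push_cast at hTk
    linarith [hu.2]
  have hi := intervalIntegrable_renewal (k + 1)
  have h2 := intervalIntegral.integral_add_adjacent_intervals (hi (-1) 0) (hi 0 T)
  have h3 := intervalIntegral.integral_add_adjacent_intervals (hi (-1) (T - 1)) (hi (T - 1) T)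
  have h4 : renewal (k + 1) T = 1 + (∫ u in (0 : ℝ)..T, renewal (k + 1) u) -
      ∫ u in (-1)..(T - 1), renewal k u := by
    rw [integral_renewal, integral_renewal, renewal, Finset.sum_range_succ',
      Finset.sum_range_succ', renewalTerm_zero_eq_integral hT,
      Finset.sum_congr rfl fun j _ => renewalTerm_succ_eq_integral j hT.le, Finset.sum_sub_distrib]
    ring
  linarith

/-- First-crossing argument: at the first point `t` where the function is at most `0`, the renewal
equation writes its value as `1` plus the integral of a function nonnegative before `t`. -/
theorem renewal_nonneg {k : ℕ} {T : ℝ} (hTk : T ≤ k) : 0 ≤ renewal k T := by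
  by_contra! hneg
  have hT : 0 < T := by
    by_contra! h
    rw [renewal_of_nonpos k h] at hneg
    exact lt_irrefl _ hneg
  obtain ⟨m, rfl⟩ : ∃ m, k = m + 1 := ⟨k - 1, by
    have : (0 : ℝ) < k := hT.trans_le hTk
    have : 0 < k := by exact_mod_cast this
    omega⟩
  -- Removing the cut-off from term `0` gives a continuous function that agrees with `renewal` on `u
  -- > 0` and equals `1` at `0`, so a least point with `f ≤ 0` exists and is positive.
  let f : ℝ → ℝ := fun u => ∑ j ∈ Finset.range m, renewalTerm (j + 1) u + Real.exp u
  have hf : Continuous f := by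
    have := fun j => continuous_renewalTerm_succ j
    fun_prop
  have hfr : ∀ u, 0 < u → renewal (m + 1) u = f u := fun u hu => by
    rw [renewal, Finset.sum_range_succ', renewalTerm_of_lt (j := 0) (by simpa using hu)]
    simp [f]
  have hf0 : 0 < f 0 := by
    have : ∑ j ∈ Finset.range m, renewalTerm (j + 1) 0 = 0 :=
      Finset.sum_eq_zero fun j _ => renewalTerm_of_le (by positivity)
    simp [f, this]
  have hS : IsCompact (Set.Icc 0 T ∩ f ⁻¹' Set.Iic 0) :=
    isCompact_Icc.inter_right (isClosed_Iic.preimage hf)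
  obtain ⟨t, ⟨⟨ht0, htT⟩, htf⟩, htmin⟩ :=
    hS.exists_isLeast ⟨T, ⟨hT.le, le_rfl⟩, by simpa [← hfr T hT] using hneg.le⟩
  have htf : f t ≤ 0 := htf
  have ht : 0 < t := lt_of_le_of_ne ht0 fun h => by rw [← h] at htf; linarith
  have h := renewal_eq_integral ht (htT.trans hTk)
  have hint : 0 ≤ ∫ u in (t - 1)..t, renewal (m + 1) u := by
    rw [intervalIntegral.integral_of_le (by linarith), ← integral_Ioc_eq_integral_Ioo.symm]
    refine setIntegral_nonneg measurableSet_Ioo fun u hu => ?_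
    rcases le_or_gt u 0 with hu0 | hu0
    · exact (renewal_of_nonpos _ hu0).ge
    · rw [hfr u hu0]
      by_contra! hlt
      exact absurd (htmin ⟨⟨hu0.le, hu.2.le.trans htT⟩, hlt.le⟩) (not_le.2 hu.2)
  rw [hfr t ht] at h
  linarith

theorem one_le_renewal {k : ℕ} {T : ℝ} (hT : 0 < T) (hTk : T ≤ k) : 1 ≤ renewal k T := by
  rw [renewal_eq_integral hT hTk]
  have : 0 ≤ ∫ u in (T - 1)..T, renewal k u :=
    intervalIntegral.integral_nonneg (by linarith) fun u hu => renewal_nonneg (hu.2.trans hTk)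
  linarith

theorem renewal_one_one : renewal 1 1 = Real.exp 1 := by
  simp [renewal, renewalTerm]

theorem renewal_two_two : renewal 2 2 = Real.exp 1 ^ 2 - Real.exp 1 := by
  have h : Real.exp 1 ^ 2 = Real.exp 2 := by rw [← Real.exp_nat_mul]; norm_num
  have h1 : (2 : ℝ) - 1 = 1 := by norm_num
  rw [h, renewal, Finset.sum_range_succ, Finset.sum_range_one, renewalTerm_of_lt (by norm_num),
    renewalTerm_of_lt (by norm_num), sub_eq_add_neg (Real.exp 2)]
  simp [h1]

theorem exists_abs_renewal_le (k : ℕ) : ∃ C, ∀ u ≤ (k : ℝ), |renewal k u| ≤ C := by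
  refine ⟨∑ j ∈ Finset.range k, (k : ℝ) ^ j / (j.factorial : ℝ) * Real.exp k, fun u hu => ?_⟩
  refine (Finset.abs_sum_le_sum_abs _ _).trans (Finset.sum_le_sum fun j _ => ?_)
  rcases le_or_gt u j with hj | hj
  · rw [renewalTerm_of_le hj, abs_zero]; positivity
  · have h0 : 0 ≤ u - j := by linarith
    have h1 : u - j ≤ k := by linarith [(Nat.cast_nonneg j : (0 : ℝ) ≤ j)]
    rw [renewalTerm_of_lt hj, abs_mul, abs_div, abs_mul, abs_pow, abs_pow, abs_neg, abs_one,
      one_pow, one_mul, Real.abs_exp, abs_of_nonneg h0, Nat.abs_cast]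
    gcongr

/-! ### The harmonic sum and the numerical bounds -/

/-- The mean number of bins covered per item by Dual Harmonic, without the smallest items. -/
noncomputable def harmonicSum (k : ℕ) : ℝ :=
  ∑ j ∈ Finset.Icc 2 k, 1 / (j : ℝ) * (1 / ((j : ℝ) - 1) - 1 / j)

/-- Each summand is `1/(j-1) - 1/j - 1/j²`, and the first two parts telescope. The range on the
right includes `j = 0`, where `1/0² = 0`, and `j = 1`, which is offset by the `2`. -/
theorem harmonicSum_eq (k : ℕ) :
    harmonicSum (k + 1) = 2 - 1 / (k + 1 : ℝ) - ∑ j ∈ Finset.range (k + 2), 1 / (j : ℝ) ^ 2 := by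
  induction k with
  | zero => norm_num [harmonicSum, Finset.sum_range_succ]
  | succ k ih =>
    rw [harmonicSum, Finset.sum_Icc_succ_top (by omega), ← harmonicSum, ih,
      Finset.sum_range_succ _ (k + 2)]
    push_cast
    have : (k : ℝ) + 1 ≠ 0 := by positivity
    have : (k : ℝ) + 1 + 1 ≠ 0 := by positivity
    have : (k : ℝ) + 2 ≠ 0 := by positivity
    have h2 : (k : ℝ) + 1 + 1 - 1 = k + 1 := by ring
    rw [h2]
    field_simp
    ring

theorem tendsto_harmonicSum : Tendsto harmonicSum atTop (𝓝 (2 - Real.pi ^ 2 / 6)) := by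
  rw [← tendsto_add_atTop_iff_nat 1]
  have h := (hasSum_zeta_two.tendsto_sum_nat.comp (tendsto_add_atTop_nat 2))
  have h1 := (tendsto_const_nhds (x := (2 : ℝ))).sub (tendsto_one_div_add_atTop_nhds_zero_nat (𝕜 := ℝ))
  refine ((h1.sub h).congr fun k => (harmonicSum_eq k).symm).trans_eq ?_
  simp

theorem abs_ratio_two_sub_lt :
    |1 / 2 + 1 / (Real.exp 1 ^ 2 - Real.exp 1) - 0.7141| < 0.00005 := by
  have h1 := Real.exp_one_gt_d9
  have h2 := Real.exp_one_lt_d9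
  have h3 : 4.67077 < Real.exp 1 ^ 2 - Real.exp 1 := by nlinarith
  have h4 : Real.exp 1 ^ 2 - Real.exp 1 < 4.67078 := by nlinarith
  have h5 := one_div_lt_one_div_of_lt (by norm_num) h3
  have h6 := one_div_lt_one_div_of_lt (by linarith) h4
  rw [abs_lt]
  constructor <;> norm_num at * <;> linarith

theorem abs_ratio_limit_sub_lt : |(12 - Real.pi ^ 2) / 3 - 0.7101| < 0.00005 := by
  have h1 := Real.pi_gt_d6
  have h2 := Real.pi_lt_d6
  rw [abs_lt]
  constructor <;> nlinarith

/-- The value `0.73` separates `2/e` from both Dual Harmonic values. -/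
theorem lt_two_div_exp_one : 0.73 < 2 / Real.exp 1 := by
  rw [lt_div_iff₀ (Real.exp_pos 1)]
  linarith [Real.exp_one_lt_d9]

/-! ### Expectations over independent uniform items -/

instance : IsProbabilityMeasure (volume.restrict (Set.Ioo (0 : ℝ) 1)) := ⟨by simp⟩

instance (n : ℕ) : IsProbabilityMeasure (uniformItems n) := by
  unfold uniformItems; infer_instance

theorem ae_uniformItems (n : ℕ) :
    ∀ᵐ x ∂uniformItems n, ∀ i, x i ∈ Set.Ioo (0 : ℝ) 1 :=
  eventually_all.2 fun i =>
    (Measure.tendsto_eval_ae_ae (μ := fun _ : Fin n => volume.restrict (Set.Ioo (0 : ℝ) 1))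
      (i := i)).eventually (ae_restrict_mem measurableSet_Ioo)

/-- Fubini with the last coordinate split off, because an online algorithm reads its items in order.
-/
theorem integral_uniformItems_succ {n : ℕ} {H : List ℝ → ℝ}
    (hH : Integrable (fun x => H (List.ofFn x)) (uniformItems (n + 1))) :
    ∫ x, H (List.ofFn x) ∂uniformItems (n + 1) =
      ∫ x, (∫ y in Set.Ioo (0 : ℝ) 1, H (List.ofFn x ++ [y])) ∂uniformItems n := by
  let e := MeasurableEquiv.piFinSuccAbove (fun _ : Fin (n + 1) => ℝ) (Fin.last n)
  have he : MeasurePreserving e.symm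
      ((volume.restrict (Set.Ioo (0 : ℝ) 1)).prod (uniformItems n)) (uniformItems (n + 1)) :=
    (measurePreserving_piFinSuccAbove
      (fun _ : Fin (n + 1) => volume.restrict (Set.Ioo (0 : ℝ) 1)) (Fin.last n)).symm
  have hz : ∀ z : ℝ × (Fin n → ℝ), H (List.ofFn (e.symm z)) = H (List.ofFn z.2 ++ [z.1]) := by
    rintro ⟨y, x⟩
    congr 1
    rw [List.ofFn_succ_last]
    simp [e, MeasurableEquiv.piFinSuccAbove]
  have hi := (he.integrable_comp_emb e.symm.measurableEmbedding).2 hH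
  rw [← he.integral_comp' (g := fun x => H (List.ofFn x))]
  simp only [hz]
  refine integral_prod_symm (fun z : ℝ × (Fin n → ℝ) => H (List.ofFn z.2 ++ [z.1])) ?_
  exact hi.congr (ae_of_all _ hz)

/-- A functional of the sequence that grows by `d` in expectation with each item has expectation
growing linearly in the number of items. -/
theorem integral_uniformItems_of_drift {H : List ℝ → ℝ} {d : ℝ}
    (hH : ∀ n, Integrable (fun x => H (List.ofFn x)) (uniformItems n))
    (hd : ∀ I : List ℝ, (∀ x ∈ I, x ∈ Set.Ioo (0 : ℝ) 1) →
      ∫ y in Set.Ioo (0 : ℝ) 1, H (I ++ [y]) = H I + d) (n : ℕ) :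
    ∫ x, H (List.ofFn x) ∂uniformItems n = H [] + n * d := by
  induction n with
  | zero => simp
  | succ n ih =>
    rw [integral_uniformItems_succ (hH _)]
    have h : ∀ᵐ x ∂uniformItems n, ∫ y in Set.Ioo (0 : ℝ) 1, H (List.ofFn x ++ [y]) =
        H (List.ofFn x) + d := by
      filter_upwards [ae_uniformItems n] with x hx
      exact hd _ (by simpa [List.mem_ofFn] using hx)
    rw [integral_congr_ae h, integral_add (hH n) (integrable_const _), ih]
    simp
    ring

/-! ### States of the algorithm and their measurability -/

theorem measurable_eval_nat {α : Type*} [MeasurableSpace α] {f : α → ℕ → ℝ} {g : α → ℕ}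
    (hf : Measurable f) (hg : Measurable g) : Measurable fun a => f a (g a) := by
  have h : Measurable fun p : (ℕ → ℝ) × ℕ => p.1 p.2 :=
    measurable_from_prod_countable_left fun j => measurable_pi_apply j
  exact h.comp (hf.prodMk hg)

theorem measurable_step {c : ℝ → ℕ} (hc : Measurable c) :
    Measurable fun p : ((ℕ → ℝ) × ℕ) × ℝ => step c p.1 p.2 := by
  have hcx : Measurable fun p : ((ℕ → ℝ) × ℕ) × ℝ => c p.2 := hc.comp measurable_snd
  have hl : Measurable fun p : ((ℕ → ℝ) × ℕ) × ℝ => p.1.1 (c p.2) + p.2 :=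
    (measurable_eval_nat (measurable_fst.comp measurable_fst) hcx).add measurable_snd
  have hu : ∀ v : ((ℕ → ℝ) × ℕ) × ℝ → ℝ, Measurable v →
      Measurable fun p => Function.update p.1.1 (c p.2) (v p) := fun v hv => by
    refine measurable_pi_iff.2 fun j => ?_
    simp only [Function.update_apply]
    exact Measurable.ite (measurableSet_eq_fun measurable_const hcx) hv (by fun_prop)
  unfold step
  refine Measurable.ite (measurableSet_le measurable_const hl) ?_ ?_
  · exact (hu _ measurable_const).prodMk (by fun_prop)
  · exact (hu _ hl).prodMk (by fun_prop)

/-- The state of the algorithm with type map `c` after the sequence `I`. -/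
noncomputable def state (c : ℝ → ℕ) (I : List ℝ) : (ℕ → ℝ) × ℕ :=
  I.foldl (step c) (fun _ => 0, 0)

theorem state_append (c : ℝ → ℕ) (I : List ℝ) (y : ℝ) :
    state c (I ++ [y]) = step c (state c I) y := by
  simp [state]

theorem measurable_state {c : ℝ → ℕ} (hc : Measurable c) (n : ℕ) :
    Measurable fun x : Fin n → ℝ => state c (List.ofFn x) := by
  induction n with
  | zero => simp [measurable_const]
  | succ n ih =>
    simp only [List.ofFn_succ_last, state_append]
    exact (measurable_step hc).comp ((ih.comp (by fun_prop)).prodMk (by fun_prop))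

theorem step_snd_le (c : ℝ → ℕ) (s : (ℕ → ℝ) × ℕ) (x : ℝ) : (step c s x).2 ≤ s.2 + 1 := by
  unfold step; split_ifs <;> simp

theorem state_snd_le (c : ℝ → ℕ) (I : List ℝ) : (state c I).2 ≤ I.length := by
  induction I using List.reverseRecOn with
  | nil => simp [state]
  | append_singleton I y ih =>
    rw [state_append, List.length_append]
    exact (step_snd_le c _ y).trans (by simpa using ih)

theorem integrable_covered {c : ℝ → ℕ} (hc : Measurable c) (n : ℕ) :
    Integrable (fun x : Fin n → ℝ => (covered c (List.ofFn x) : ℝ)) (uniformItems n) := by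
  refine Integrable.of_bound (C := n) ?_ (ae_of_all _ fun x => ?_)
  · exact (measurable_from_nat.comp
      (measurable_snd.comp (measurable_state hc n))).aestronglyMeasurable
  · rw [Real.norm_natCast]
    exact_mod_cast (state_snd_le c (List.ofFn x)).trans_eq (List.length_ofFn)

/-! ### Harmonic type maps and the potential -/

/-- The type map `c` sorts the items of size at least `1/k` harmonically, and gives type `t` to
all smaller ones. -/
structure IsHarmonicMap (k t : ℕ) (c : ℝ → ℕ) : Prop where
  one_le : 1 ≤ k
  notMem : t ∉ Finset.Icc 2 k
  measurable : Measurable c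
  small : ∀ x ∈ Set.Ioo (0 : ℝ) (1 / k), c x = t
  large : ∀ x ∈ Set.Ico (1 / (k : ℝ)) 1, c x = ⌈1 / x⌉₊

theorem measurable_natCeil_one_div : Measurable fun x : ℝ => ⌈1 / x⌉₊ :=
  Nat.measurable_ceil.comp (measurable_const.div measurable_id)

theorem isHarmonicMap_harmonicType {k : ℕ} (hk : 2 ≤ k) :
    IsHarmonicMap k (k + 1) (harmonicType k) where
  one_le := by omega
  notMem := by simp
  measurable := measurable_natCeil_one_div.min measurable_const
  small x hx := (harmonicType_eq_succ_iff hk hx.1).2 hx.2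
  large x hx := by
    have hk0 : (0 : ℝ) < 1 / k := by positivity
    have h : ⌈1 / x⌉₊ ≤ k := Nat.ceil_le.2 ((one_div_le (hk0.trans_le hx.1) (by positivity)).2 hx.1)
    unfold harmonicType
    omega

/-- With `k = 1` there are no harmonic types and every item is small. -/
theorem isHarmonicMap_const : IsHarmonicMap 1 0 fun _ => 0 where
  one_le := le_rfl
  notMem := by simp
  measurable := measurable_const
  small _ _ := rfl
  large x hx := by
    have := hx.1.trans_lt hx.2
    norm_num at this

theorem natCeil_one_div_facts {k : ℕ} (hk : 1 ≤ k) {x : ℝ} (hx : x ∈ Set.Ico (1 / (k : ℝ)) 1) :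
    ⌈1 / x⌉₊ ∈ Finset.Icc 2 k ∧ 1 ≤ ⌈1 / x⌉₊ * x ∧ ((⌈1 / x⌉₊ : ℝ) - 1) * x < 1 := by
  have hk0 : (0 : ℝ) < k := by exact_mod_cast hk
  have hx0 : 0 < x := (one_div_pos.2 hk0).trans_le hx.1
  have h1 : 1 < 1 / x := (one_lt_div hx0).2 hx.2
  refine ⟨Finset.mem_Icc.2 ⟨Nat.lt_ceil.2 (by simpa using h1),
    Nat.ceil_le.2 ((one_div_le hx0 hk0).2 hx.1)⟩, ?_, ?_⟩
  · rw [← div_le_iff₀ hx0]; exact Nat.le_ceil _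
  · rw [← lt_div_iff₀ hx0]
    linarith [Nat.ceil_lt_add_one (one_div_pos.2 hx0).le]

/-- A bound for the states that occur: all levels are in `[0,1)`, and an open bin of a type
`j ≤ k` contains items of sizes in `[1/j, 1/(j-1))` only, hence `⌊j * level⌋` of them. -/
def Admissible (k : ℕ) (s : (ℕ → ℝ) × ℕ) : Prop :=
  (∀ j, s.1 j ∈ Set.Ico (0 : ℝ) 1) ∧
    ∀ j ∈ Finset.Icc 2 k, ((j : ℝ) - 1) * s.1 j ≤ (⌊(j : ℝ) * s.1 j⌋ : ℝ)

/-- The number of covered bins, with a fractional credit for each open bin that makes the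
conditional expectation of its increment constant. -/
noncomputable def potential (k t : ℕ) (s : (ℕ → ℝ) × ℕ) : ℝ :=
  s.2 + ∑ j ∈ Finset.Icc 2 k, (⌊(j : ℝ) * s.1 j⌋ : ℝ) / j +
    (1 - renewal k (k * (1 - s.1 t)) / renewal k k)

/-- The increase of the potential when an item of size `x` arrives and the open bin of the
smallest items has level `l`. -/
noncomputable def increment (k : ℕ) (l x : ℝ) : ℝ :=
  if x < 1 / k then (renewal k (k * (1 - l)) - renewal k (k * (1 - l - x))) / renewal k k
  else 1 / (⌈1 / x⌉₊ : ℝ)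

theorem sum_update (S : Finset ℕ) (φ : ℕ → ℝ → ℝ) (s : ℕ → ℝ) {i : ℕ} (hi : i ∈ S) (v : ℝ) :
    ∑ j ∈ S, φ j (Function.update s i v j) = ∑ j ∈ S, φ j (s j) + (φ i v - φ i (s i)) := by
  rw [← Finset.add_sum_erase S _ hi, ← Finset.add_sum_erase S (fun j => φ j (s j)) hi,
    Function.update_self, Finset.sum_congr rfl fun j hj => by
      rw [Function.update_of_ne (Finset.ne_of_mem_erase hj)]]
  ring

theorem renewal_self_pos {k : ℕ} (hk : 1 ≤ k) : 0 < renewal k k :=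
  zero_lt_one.trans_le (one_le_renewal (by exact_mod_cast hk) le_rfl)

theorem admissible_update {k i n : ℕ} {s : (ℕ → ℝ) × ℕ} (hs : Admissible k s) {v : ℝ}
    (hv : v ∈ Set.Ico (0 : ℝ) 1)
    (hvi : i ∈ Finset.Icc 2 k → ((i : ℝ) - 1) * v ≤ (⌊(i : ℝ) * v⌋ : ℝ)) :
    Admissible k (Function.update s.1 i v, n) := by
  refine ⟨fun j => ?_, fun j hj => ?_⟩ <;> rcases eq_or_ne j i with rfl | hji
  · simpa using hv
  · simpa [hji] using hs.1 j
  · simpa using hvi hj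
  · simpa [hji] using hs.2 j hj

theorem step_small {k t : ℕ} {c : ℝ → ℕ} (hc : IsHarmonicMap k t c) {s : (ℕ → ℝ) × ℕ}
    (hs : Admissible k s) {x : ℝ} (hx : x ∈ Set.Ioo (0 : ℝ) (1 / k)) :
    Admissible k (step c s x) ∧
      potential k t (step c s x) = potential k t s + increment k (s.1 t) x := by
  have hk := renewal_self_pos hc.one_le
  have hsum : ∀ v, ∑ j ∈ Finset.Icc 2 k, (⌊(j : ℝ) * Function.update s.1 t v j⌋ : ℝ) / j =
      ∑ j ∈ Finset.Icc 2 k, (⌊(j : ℝ) * s.1 j⌋ : ℝ) / j := fun v =>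
    Finset.sum_congr rfl fun j hj => by
      rw [Function.update_of_ne]; rintro rfl; exact hc.notMem hj
  have h0 := (hs.1 t).1
  rw [increment, if_pos hx.2, step, hc.small x hx]
  split_ifs with h
  · refine ⟨admissible_update hs (by simp) (by simp), ?_⟩
    -- Covering the bin leaves no deficit, so the credit would reach `1`; it is exchanged for the
    -- covered bin, and the empty bin has credit `0`.
    have hr : renewal k (k * (1 - s.1 t - x)) = 0 :=
      renewal_of_nonpos k (mul_nonpos_of_nonneg_of_nonpos (Nat.cast_nonneg k) (by linarith))
    simp only [potential, hsum, Function.update_self, hr]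
    rw [sub_zero, mul_one, div_self hk.ne']
    push_cast
    ring
  · refine ⟨admissible_update hs ⟨by linarith [hx.1], not_le.1 h⟩ fun h => absurd h hc.notMem, ?_⟩
    simp only [potential, hsum, Function.update_self]
    rw [show (k : ℝ) * (1 - s.1 t - x) = k * (1 - (s.1 t + x)) by ring]
    ring

/-- Each item of type `i` raises `⌊i * level⌋` by one until the bin closes at `i - 1`; there the
credit `(i - 1)/i` is exchanged for a full bin, again a gain of `1/i`. -/
theorem step_large {k t : ℕ} {c : ℝ → ℕ} (hc : IsHarmonicMap k t c) {s : (ℕ → ℝ) × ℕ}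
    (hs : Admissible k s) {x : ℝ} (hx : x ∈ Set.Ico (1 / (k : ℝ)) 1) :
    Admissible k (step c s x) ∧
      potential k t (step c s x) = potential k t s + increment k (s.1 t) x := by
  obtain ⟨hj, h1, h2⟩ := natCeil_one_div_facts hc.one_le hx
  rw [increment, if_neg (not_lt.2 hx.1), step, hc.large x hx]
  generalize ⌈1 / x⌉₊ = i at *
  have hti : t ≠ i := fun h => hc.notMem (h ▸ hj)
  have hi2 : (2 : ℝ) ≤ i := by exact_mod_cast (Finset.mem_Icc.1 hj).1
  have hi0 : (i : ℝ) ≠ 0 := by positivity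
  have h3 := hs.2 i hj
  have h4 := Int.floor_le ((i : ℝ) * s.1 i)
  have h5 := Int.lt_floor_add_one ((i : ℝ) * s.1 i)
  have h6 := hs.1 i
  have hx0 : 0 < x := by
    have : 0 < i * x := by linarith
    exact pos_of_mul_pos_right this (by positivity)
  have h7 : ⌊(i : ℝ) * s.1 i⌋ + 1 ≤ (i : ℤ) := by
    rw [Int.add_one_le_iff, Int.floor_lt]
    push_cast
    nlinarith [h6.2]
  split_ifs with h
  · refine ⟨admissible_update hs (by simp) (by simp), ?_⟩
    -- From `(i-1)(level + x) ≥ i - 1` and `(i-1)x < 1`, admissibility gives `⌊i * level⌋ > i - 2`: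
    -- the bin cannot close early.
    have h8 : (i : ℤ) ≤ ⌊(i : ℝ) * s.1 i⌋ + 1 := by
      have : (i : ℝ) < (⌊(i : ℝ) * s.1 i⌋ : ℝ) + 1 + 1 := by nlinarith
      have : (i : ℤ) < ⌊(i : ℝ) * s.1 i⌋ + 1 + 1 := by exact_mod_cast this
      omega
    have h9 : (⌊(i : ℝ) * s.1 i⌋ : ℝ) = i - 1 := by
      have : ⌊(i : ℝ) * s.1 i⌋ = i - 1 := by omega
      rw [this]; push_cast; rfl
    simp only [potential, sum_update _ (fun j l => (⌊(j : ℝ) * l⌋ : ℝ) / j) s.1 hj,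
      Function.update_of_ne hti, h9, mul_zero, Int.floor_zero]
    push_cast
    field_simp
    ring
  -- The lower bound uses `i * x ≥ 1`. The upper bound adds `(i-1) * level ≤ ⌊i * level⌋`, `(i-1)x <
  -- 1` and `level + x < 1`.
  · have h8 : ⌊(i : ℝ) * (s.1 i + x)⌋ = ⌊(i : ℝ) * s.1 i⌋ + 1 := by
      rw [Int.floor_eq_iff]
      push_cast
      constructor <;> nlinarith
    refine ⟨admissible_update hs ⟨by linarith [h6.1], not_le.1 h⟩ fun _ => ?_, ?_⟩
    · rw [h8]
      push_cast
      nlinarith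
    · simp only [potential, sum_update _ (fun j l => (⌊(j : ℝ) * l⌋ : ℝ) / j) s.1 hj,
        Function.update_of_ne hti, h8]
      push_cast
      field_simp
      ring

theorem step_admissible {k t : ℕ} {c : ℝ → ℕ} (hc : IsHarmonicMap k t c) {s : (ℕ → ℝ) × ℕ}
    (hs : Admissible k s) {x : ℝ} (hx : x ∈ Set.Ioo (0 : ℝ) 1) :
    Admissible k (step c s x) ∧
      potential k t (step c s x) = potential k t s + increment k (s.1 t) x := by
  rcases lt_or_ge x (1 / k) with h | h
  · exact step_small hc hs ⟨hx.1, h⟩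
  · exact step_large hc hs ⟨h, hx.2⟩

theorem state_admissible {k t : ℕ} {c : ℝ → ℕ} (hc : IsHarmonicMap k t c) (I : List ℝ)
    (hI : ∀ x ∈ I, x ∈ Set.Ioo (0 : ℝ) 1) : Admissible k (state c I) := by
  induction I using List.reverseRecOn with
  | nil => simp [state, Admissible]
  | append_singleton I y ih =>
    rw [state_append]
    exact (step_admissible hc (ih fun x hx => hI x (by simp [hx])) (hI y (by simp))).1

/-! ### The expected increment and the growth of the covered count -/

theorem intervalIntegrable_one_div_natCeil (a b : ℝ) :
    IntervalIntegrable (fun x : ℝ => 1 / (⌈1 / x⌉₊ : ℝ)) volume a b := by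
  rw [intervalIntegrable_iff]
  refine Measure.integrableOn_of_bounded (M := 1) (by simp) ?_ (ae_of_all _ fun x => ?_)
  · exact ((measurable_of_countable fun n : ℕ => 1 / (n : ℝ)).comp
      measurable_natCeil_one_div).aestronglyMeasurable
  · rw [Real.norm_of_nonneg (by positivity)]
    rcases Nat.eq_zero_or_pos ⌈1 / x⌉₊ with h | h
    · rw [h]; simp
    · exact div_le_one_of_le₀ (by exact_mod_cast h) (by positivity)

theorem integral_one_div_natCeil {k : ℕ} (hk : 1 ≤ k) :
    ∫ x in (1 / (k : ℝ))..1, 1 / (⌈1 / x⌉₊ : ℝ) = harmonicSum k := by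
  induction k, hk using Nat.le_induction with
  | base => simp [harmonicSum]
  | succ k hk ih =>
    have hk0 : (0 : ℝ) < k := by exact_mod_cast hk
    have hle : 1 / ((k + 1 : ℕ) : ℝ) ≤ 1 / (k : ℝ) := by
      gcongr; simp
    have h : ∫ x in (1 / ((k + 1 : ℕ) : ℝ))..(1 / (k : ℝ)), 1 / (⌈1 / x⌉₊ : ℝ) =
        ∫ _ in (1 / ((k + 1 : ℕ) : ℝ))..(1 / (k : ℝ)), 1 / ((k + 1 : ℕ) : ℝ) := by
      -- Endpoints are dropped because the ceiling at `1/k` is `k`, not `k + 1`.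
      rw [intervalIntegral.integral_of_le hle, intervalIntegral.integral_of_le hle,
        integral_Ioc_eq_integral_Ioo, integral_Ioc_eq_integral_Ioo]
      refine setIntegral_congr_fun measurableSet_Ioo fun x hx => ?_
      have hx0 : 0 < x := lt_trans (by positivity) hx.1
      have hceil : ⌈1 / x⌉₊ = k + 1 := by
        rw [Nat.ceil_eq_iff (by omega), Nat.add_sub_cancel]
        exact ⟨(lt_one_div hk0 hx0).2 hx.2, (one_div_le hx0 (by positivity)).2 hx.1.le⟩
      simp only [hceil]
    rw [← intervalIntegral.integral_add_adjacent_intervals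
      (intervalIntegrable_one_div_natCeil _ (1 / (k : ℝ)))
      (intervalIntegrable_one_div_natCeil _ _), ih, h, intervalIntegral.integral_const,
      harmonicSum, harmonicSum, Finset.sum_Icc_succ_top (by omega)]
    push_cast
    rw [smul_eq_mul, add_sub_cancel_right]
    ring

/-- The expected number of bins covered per item. -/
noncomputable def coverRate (k : ℕ) : ℝ := harmonicSum k + 1 / (k * renewal k k)

theorem integral_increment {k : ℕ} (hk : 1 ≤ k) {l : ℝ} (hl : l ∈ Set.Ico (0 : ℝ) 1) :
    IntegrableOn (increment k l) (Set.Ioo 0 1) ∧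
      ∫ x in Set.Ioo (0 : ℝ) 1, increment k l x = coverRate k := by
  have hk0 : (0 : ℝ) < k := by exact_mod_cast hk
  have hk1 : (1 : ℝ) / k ≤ 1 := div_le_one_of_le₀ (by exact_mod_cast hk) hk0.le
  have hkp : (0 : ℝ) < 1 / k := by positivity
  have hr := renewal_self_pos hk
  have hT : 0 < k * (1 - l) := mul_pos hk0 (by linarith [hl.2])
  have hTk : k * (1 - l) ≤ k := by nlinarith [hl.1]
  have hie : ∀ x, renewal k (k * (1 - l - x)) = renewal k (k * (1 - l) - k * x) := fun x => by
    rw [mul_sub (k : ℝ) (1 - l) x]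
  have hi : IntervalIntegrable (fun x => renewal k (k * (1 - l) - k * x)) volume 0 (1 / k) := by
    have h1 := (intervalIntegrable_renewal k (k * (1 - l)) (k * (1 - l) - 1)).comp_sub_left
      (k * (1 - l))
    have h2 := h1.comp_mul_left (c := (k : ℝ))
    simpa using h2
  have hsi : IntervalIntegrable (fun x =>
      (renewal k (k * (1 - l)) - renewal k (k * (1 - l - x))) / renewal k k) volume 0 (1 / k) := by
    simp only [hie]
    exact (intervalIntegrable_const.sub hi).div_const _
  have hsmall : ∫ x in (0 : ℝ)..(1 / k),
      (renewal k (k * (1 - l)) - renewal k (k * (1 - l - x))) / renewal k k =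
        1 / (k * renewal k k) := by
    simp only [hie]
    -- With `T = k(1-l)`, the substitution `u = T - kx` gives `(1/k) ∫_{T-1}^T m = (m(T) - 1)/k`, so
    -- the dependence on `l` cancels.
    rw [intervalIntegral.integral_div, intervalIntegral.integral_sub intervalIntegrable_const hi,
      intervalIntegral.integral_comp_sub_mul _ hk0.ne', intervalIntegral.integral_const,
      mul_zero, sub_zero, sub_zero, mul_one_div_cancel hk0.ne']
    have h := renewal_eq_integral hT hTk
    simp only [smul_eq_mul]
    rw [show ∫ x in (k * (1 - l) - 1)..(k * (1 - l)), renewal k x =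
      renewal k (k * (1 - l)) - 1 by linarith]
    field_simp
    ring
  have hc1 : Set.EqOn (fun x => (renewal k (k * (1 - l)) - renewal k (k * (1 - l - x))) /
      renewal k k) (increment k l) (Set.Ioo 0 (1 / k)) := fun x hx => by
    simp only [increment, if_pos hx.2]
  have hc2 : Set.EqOn (fun x => 1 / (⌈1 / x⌉₊ : ℝ)) (increment k l) (Set.Ico (1 / (k : ℝ)) 1) :=
    fun x hx => by simp only [increment, if_neg (not_lt.2 hx.1)]
  have hi1 : IntegrableOn (increment k l) (Set.Ioo 0 (1 / k)) :=
    (((intervalIntegrable_iff_integrableOn_Ioo_of_le hkp.le).1 hsi)).congr_fun hc1 measurableSet_Ioo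
  have hi2 : IntegrableOn (increment k l) (Set.Ico (1 / (k : ℝ)) 1) :=
    ((intervalIntegrable_iff_integrableOn_Ico_of_le hk1).1
      (intervalIntegrable_one_div_natCeil _ _)).congr_fun hc2 measurableSet_Ico
  have hU : Set.Ioo (0 : ℝ) 1 = Set.Ioo 0 (1 / (k : ℝ)) ∪ Set.Ico (1 / (k : ℝ)) 1 :=
    (Set.Ioo_union_Ico_eq_Ioo hkp hk1).symm
  have hdisj : Disjoint (Set.Ioo 0 (1 / (k : ℝ))) (Set.Ico (1 / (k : ℝ)) 1) :=
    Set.disjoint_left.2 fun x hx hx' => absurd hx'.1 (not_le.2 hx.2)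
  rw [hU]
  refine ⟨hi1.union hi2, ?_⟩
  rw [setIntegral_union hdisj measurableSet_Ico hi1 hi2,
    ← setIntegral_congr_fun measurableSet_Ioo hc1, ← setIntegral_congr_fun measurableSet_Ico hc2,
    ← integral_Ioc_eq_integral_Ioo, ← intervalIntegral.integral_of_le hkp.le, hsmall,
    integral_Ico_eq_integral_Ioo, ← integral_Ioc_eq_integral_Ioo,
    ← intervalIntegral.integral_of_le hk1, integral_one_div_natCeil hk, coverRate, add_comm]

theorem exists_abs_potential_sub_le (k t : ℕ) (hk : 1 ≤ k) :
    ∃ C, ∀ s, Admissible k s → |potential k t s - s.2| ≤ C := by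
  obtain ⟨B, hB⟩ := exists_abs_renewal_le k
  refine ⟨∑ j ∈ Finset.Icc 2 k, (1 : ℝ) + (1 + B), fun s hs => ?_⟩
  have hr : 1 ≤ renewal k k := one_le_renewal (by exact_mod_cast hk) le_rfl
  have hl := (hs.1 t).1
  have hk0 : (0 : ℝ) ≤ k := by positivity
  have hb := hB (k * (1 - s.1 t)) (by nlinarith)
  rw [potential, add_assoc, add_sub_cancel_left]
  refine (abs_add_le _ _).trans (add_le_add ((Finset.abs_sum_le_sum_abs _ _).trans
    (Finset.sum_le_sum fun j hj => ?_)) ((abs_sub _ _).trans ?_))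
  · have hj0 : (0 : ℝ) < j := by
      have := (Finset.mem_Icc.1 hj).1
      exact_mod_cast (by omega : 0 < j)
    have hf0 : (0 : ℝ) ≤ (⌊(j : ℝ) * s.1 j⌋ : ℝ) := by
      exact_mod_cast Int.floor_nonneg.2 (mul_nonneg hj0.le (hs.1 j).1)
    rw [abs_of_nonneg (by positivity), div_le_one hj0]
    nlinarith [Int.floor_le ((j : ℝ) * s.1 j), (hs.1 j).2]
  · rw [abs_one, abs_div, abs_of_pos (zero_lt_one.trans_le hr)]
    have := div_le_self (abs_nonneg (renewal k (k * (1 - s.1 t)))) hr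
    linarith

theorem measurable_potential (k t : ℕ) : Measurable (potential k t) := by
  have hl : ∀ j, Measurable fun s : (ℕ → ℝ) × ℕ => s.1 j := fun j =>
    (measurable_pi_apply j).comp measurable_fst
  refine (Measurable.add (measurable_from_nat.comp measurable_snd)
    (Finset.measurable_fun_sum _ fun j _ => ?_)).add ?_
  · exact ((measurable_of_countable fun z : ℤ => (z : ℝ)).comp
      (Int.measurable_floor.comp ((hl j).const_mul _))).div_const _
  · exact measurable_const.sub (((measurable_renewal k).comp
      ((measurable_const.sub (hl t)).const_mul _)).div_const _)

theorem integrable_potential {k t : ℕ} {c : ℝ → ℕ} (hc : IsHarmonicMap k t c) (n : ℕ) :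
    Integrable (fun x => potential k t (state c (List.ofFn x))) (uniformItems n) := by
  obtain ⟨C, hC⟩ := exists_abs_potential_sub_le k t hc.one_le
  refine Integrable.of_bound (C := C + n)
    ((measurable_potential k t).comp (measurable_state hc.measurable n)).aestronglyMeasurable ?_
  filter_upwards [ae_uniformItems n] with x hx
  have h1 := hC _ (state_admissible hc (List.ofFn x) (by simpa [List.mem_ofFn] using hx))
  have h2 : ((state c (List.ofFn x)).2 : ℝ) ≤ n := by
    exact_mod_cast (state_snd_le c (List.ofFn x)).trans_eq List.length_ofFn
  have h3 : (0 : ℝ) ≤ (state c (List.ofFn x)).2 := by positivity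
  rw [Real.norm_eq_abs]
  rw [abs_le] at h1 ⊢
  constructor <;> linarith [h1.1, h1.2]

theorem integral_potential {k t : ℕ} {c : ℝ → ℕ} (hc : IsHarmonicMap k t c) (n : ℕ) :
    ∫ x, potential k t (state c (List.ofFn x)) ∂uniformItems n =
      potential k t (state c []) + n * coverRate k := by
  refine integral_uniformItems_of_drift (H := fun I => potential k t (state c I))
    (integrable_potential hc) (fun I hI => ?_) n
  have hs := state_admissible hc I hI
  obtain ⟨h1, h2⟩ := integral_increment hc.one_le (hs.1 t)
  simp only [state_append]
  rw [setIntegral_congr_fun measurableSet_Ioo fun y hy => (step_admissible hc hs hy).2,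
    integral_add (integrable_const _) h1, h2]
  simp

theorem tendsto_integral_covered_div {k t : ℕ} {c : ℝ → ℕ} (hc : IsHarmonicMap k t c) :
    Tendsto (fun n : ℕ => (∫ x, (covered c (List.ofFn x) : ℝ) ∂uniformItems n) / n) atTop
      (𝓝 (coverRate k)) := by
  obtain ⟨C, hC⟩ := exists_abs_potential_sub_le k t hc.one_le
  set P := potential k t (state c []) with hP
  have hb : ∀ n : ℕ, |(∫ x, (covered c (List.ofFn x) : ℝ) ∂uniformItems n) - n * coverRate k| ≤
      C + |P| := fun n => by
    have h := norm_integral_le_of_norm_le_const (μ := uniformItems n) (C := C)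
      (f := fun x => potential k t (state c (List.ofFn x)) - (covered c (List.ofFn x) : ℝ)) (by
        filter_upwards [ae_uniformItems n] with x hx
        exact hC _ (state_admissible hc (List.ofFn x) (by simpa [List.mem_ofFn] using hx)))
    rw [integral_sub (integrable_potential hc n) (integrable_covered hc.measurable n),
      integral_potential hc, ← hP, Real.norm_eq_abs] at h
    simp only [probReal_univ, mul_one] at h
    rw [abs_le] at h ⊢
    constructor <;> linarith [h.1, h.2, neg_abs_le P, le_abs_self P]
  have h0 : Tendsto (fun n : ℕ => (C + |P|) / (n : ℝ)) atTop (𝓝 0) :=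
    tendsto_const_div_atTop_nhds_zero_nat _
  rw [tendsto_iff_norm_sub_tendsto_zero]
  refine squeeze_zero' (Eventually.of_forall fun _ => norm_nonneg _) ?_ h0
  filter_upwards [eventually_gt_atTop 0] with n hn
  have hn0 : (0 : ℝ) < n := by exact_mod_cast hn
  rw [Real.norm_eq_abs, div_sub' hn0.ne', abs_div, abs_of_pos hn0]
  gcongr
  exact hb n

theorem tendsto_coverRate : Tendsto coverRate atTop (𝓝 (2 - Real.pi ^ 2 / 6)) := by
  have h : Tendsto (fun k : ℕ => 1 / (k * renewal k k)) atTop (𝓝 0) := by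
    refine squeeze_zero' ?_ ?_ (tendsto_one_div_atTop_nhds_zero_nat (𝕜 := ℝ))
    · filter_upwards [eventually_ge_atTop 1] with k hk
      have := renewal_self_pos hk
      positivity
    · filter_upwards [eventually_ge_atTop 1] with k hk
      have hk0 : (0 : ℝ) < k := by exact_mod_cast hk
      exact one_div_le_one_div_of_le hk0 (le_mul_of_one_le_right hk0.le (one_le_renewal hk0 le_rfl))
  exact (tendsto_harmonicSum.add h).trans_eq (by rw [add_zero])

theorem coverRate_one : coverRate 1 = 1 / Real.exp 1 := by
  simp [coverRate, harmonicSum, renewal_one_one]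

theorem coverRate_two : coverRate 2 = (1 / 2 + 1 / (Real.exp 1 ^ 2 - Real.exp 1)) / 2 := by
  norm_num [coverRate, harmonicSum, renewal_two_two]
  ring

/-! ### Deterministic bounds and integrability for the optimum -/

theorem exists_opt_eq {n : ℕ} (x : Fin n → ℝ) : ∃ f : Fin n → Fin n,
    opt x = (Finset.univ.filter fun b : Fin n => 1 ≤ ∑ i with f i = b, x i).card := by
  obtain ⟨f, -, hf⟩ := Finset.exists_mem_eq_sup Finset.univ ⟨(id : Fin n → Fin n), Finset.mem_univ _⟩
    fun f : Fin n → Fin n => (Finset.univ.filter fun b : Fin n => 1 ≤ ∑ i with f i = b, x i).card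
  exact ⟨f, hf⟩

theorem opt_le_length {n : ℕ} (x : Fin n → ℝ) : opt x ≤ n := by
  obtain ⟨f, hf⟩ := exists_opt_eq x
  rw [hf]
  exact (Finset.card_le_univ _).trans_eq (Fintype.card_fin n)

theorem opt_le_sum {n : ℕ} {x : Fin n → ℝ} (hx : ∀ i, 0 ≤ x i) : (opt x : ℝ) ≤ ∑ i, x i := by
  obtain ⟨f, hf⟩ := exists_opt_eq x
  rw [hf, ← Finset.sum_fiberwise Finset.univ f x, Finset.card_eq_sum_ones, Nat.cast_sum]
  calc _ ≤ ∑ b with 1 ≤ ∑ i with f i = b, x i, ∑ i with f i = b, x i :=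
        Finset.sum_le_sum fun b hb => by simpa using (Finset.mem_filter.1 hb).2
    _ ≤ _ := Finset.sum_le_sum_of_subset_of_nonneg (Finset.subset_univ _)
        fun b _ _ => Finset.sum_nonneg fun i _ => hx i

theorem card_le_opt_of_matching {n : ℕ} {x : Fin n → ℝ} {κ : Type*} [Fintype κ] {u v : κ → Fin n}
    (hu : Function.Injective u) (hv : Function.Injective v) (huv : ∀ a b, u a ≠ v b)
    (h : ∀ a, 1 ≤ x (u a) + x (v a)) : Fintype.card κ ≤ opt x := by
  classical
  -- The packing puts item `v a` into bin `u a` and every other item into the bin of its own index,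
  -- so bin `u a` holds exactly the pair.
  refine le_trans ?_ (Finset.le_sup (f := fun f : Fin n → Fin n =>
    (Finset.univ.filter fun b : Fin n => 1 ≤ ∑ i with f i = b, x i).card)
    (Finset.mem_univ (Function.extend v u id)))
  rw [← Finset.card_univ]
  refine Finset.card_le_card_of_injOn u (fun a _ => ?_) hu.injOn
  have hset : (Finset.univ.filter fun i => Function.extend v u id i = u a) = {u a, v a} := by
    ext i
    simp only [Finset.mem_filter, Finset.mem_univ, true_and, Finset.mem_insert,
      Finset.mem_singleton]
    by_cases hi : ∃ b, v b = i
    · obtain ⟨b, rfl⟩ := hi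
      rw [hv.extend_apply, hu.eq_iff, hv.eq_iff]
      exact ⟨Or.inr, fun h => h.resolve_left fun h => huv a b h.symm⟩
    · rw [Function.extend_apply' _ _ _ hi]
      exact ⟨Or.inl, fun h => h.resolve_right fun h => hi ⟨a, h.symm⟩⟩
  simpa [hset, Finset.sum_pair (huv a a)] using h a

theorem measurable_opt (n : ℕ) : Measurable fun x : Fin n → ℝ => opt x := by
  -- Stated for any finite set of packings, to allow induction.
  have h : ∀ S : Finset (Fin n → Fin n), Measurable fun x : Fin n → ℝ => S.sup fun f =>
      (Finset.univ.filter fun b : Fin n => 1 ≤ ∑ i with f i = b, x i).card := fun S => by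
    classical
    induction S using Finset.induction_on with
    | empty => simp [measurable_const]
    | insert f S _ ih =>
      simp only [Finset.sup_insert]
      refine Measurable.max ?_ ih
      simp only [Finset.card_filter]
      exact Finset.measurable_fun_sum _ fun b _ => Measurable.ite
        (measurableSet_le measurable_const
          (Finset.measurable_fun_sum _ fun i _ => measurable_pi_apply i))
        measurable_const measurable_const
  exact h _

theorem integrable_opt (n : ℕ) :
    Integrable (fun x : Fin n → ℝ => (opt x : ℝ)) (uniformItems n) := by
  refine Integrable.of_bound (C := n)
    (measurable_from_nat.comp (measurable_opt n)).aestronglyMeasurable (ae_of_all _ fun x => ?_)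
  rw [Real.norm_natCast]
  exact_mod_cast opt_le_length x

/-! ### Moments of sums of independent terms -/

theorem ae_abs_sum_le {d : ℝ → ℝ} (hb : ∀ y ∈ Set.Ioo (0 : ℝ) 1, |d y| ≤ 1) (n : ℕ) :
    ∀ᵐ x ∂uniformItems n, |((List.ofFn x).map d).sum| ≤ n := by
  filter_upwards [ae_uniformItems n] with x hx
  rw [List.map_ofFn, List.sum_ofFn]
  refine (Finset.abs_sum_le_sum_abs _ _).trans
    ((Finset.sum_le_sum fun i _ => hb (x i) (hx i)).trans_eq ?_)
  simp

theorem measurable_sum_map {d : ℝ → ℝ} (hd : Measurable d) (n : ℕ) :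
    Measurable fun x : Fin n → ℝ => ((List.ofFn x).map d).sum := by
  simp only [List.map_ofFn, List.sum_ofFn]
  exact Finset.measurable_fun_sum _ fun i _ => hd.comp (measurable_pi_apply i)

theorem integrable_sum_map {d : ℝ → ℝ} (hd : Measurable d)
    (hb : ∀ y ∈ Set.Ioo (0 : ℝ) 1, |d y| ≤ 1) (n : ℕ) :
    Integrable (fun x => ((List.ofFn x).map d).sum) (uniformItems n) :=
  Integrable.of_bound (measurable_sum_map hd n).aestronglyMeasurable n (ae_abs_sum_le hb n)

theorem integrable_sum_map_sq {d : ℝ → ℝ} (hd : Measurable d)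
    (hb : ∀ y ∈ Set.Ioo (0 : ℝ) 1, |d y| ≤ 1) (n : ℕ) :
    Integrable (fun x => ((List.ofFn x).map d).sum ^ 2) (uniformItems n) := by
  refine Integrable.of_bound ((measurable_sum_map hd n).pow_const 2).aestronglyMeasurable
    ((n : ℝ) ^ 2) ?_
  filter_upwards [ae_abs_sum_le hb n] with x hx
  rw [norm_pow, Real.norm_eq_abs]
  gcongr

theorem integrableOn_of_abs_le_one {d : ℝ → ℝ} (hd : Measurable d)
    (hb : ∀ y ∈ Set.Ioo (0 : ℝ) 1, |d y| ≤ 1) : IntegrableOn d (Set.Ioo 0 1) :=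
  Integrable.of_bound hd.aestronglyMeasurable 1
    ((ae_restrict_mem measurableSet_Ioo).mono fun y hy => hb y hy)

theorem integral_sum_map {d : ℝ → ℝ} (hd : Measurable d)
    (hb : ∀ y ∈ Set.Ioo (0 : ℝ) 1, |d y| ≤ 1) (n : ℕ) :
    ∫ x, ((List.ofFn x).map d).sum ∂uniformItems n = n * ∫ y in Set.Ioo (0 : ℝ) 1, d y := by
  have h := integral_uniformItems_of_drift (H := fun I => (I.map d).sum)
    (d := ∫ y in Set.Ioo (0 : ℝ) 1, d y) (integrable_sum_map hd hb) (fun I _ => ?_) n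
  · simpa using h
  · simp only [List.map_append, List.sum_append, List.map_cons, List.map_nil, List.sum_singleton]
    rw [integral_add (integrable_const _) (integrableOn_of_abs_le_one hd hb)]
    simp

/-- Drift argument for the squared sum: the cross term vanishes because `d` has mean zero. -/
theorem integral_sum_map_sq {d : ℝ → ℝ} (hd : Measurable d)
    (hb : ∀ y ∈ Set.Ioo (0 : ℝ) 1, |d y| ≤ 1) (h0 : ∫ y in Set.Ioo (0 : ℝ) 1, d y = 0) (n : ℕ) :
    ∫ x, ((List.ofFn x).map d).sum ^ 2 ∂uniformItems n =
      n * ∫ y in Set.Ioo (0 : ℝ) 1, d y ^ 2 := by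
  have hb2 : ∀ y ∈ Set.Ioo (0 : ℝ) 1, |d y ^ 2| ≤ 1 := fun y hy => by
    rw [abs_pow]; exact pow_le_one₀ (abs_nonneg _) (hb y hy)
  have h := integral_uniformItems_of_drift (H := fun I => (I.map d).sum ^ 2)
    (d := ∫ y in Set.Ioo (0 : ℝ) 1, d y ^ 2) (integrable_sum_map_sq hd hb) (fun I _ => ?_) n
  · simpa using h
  · have hi := integrableOn_of_abs_le_one hd hb
    have hi2 := integrableOn_of_abs_le_one (hd.pow_const 2) hb2
    simp only [List.map_append, List.sum_append, List.map_cons, List.map_nil, List.sum_singleton,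
      add_sq]
    have hi3 : IntegrableOn (fun y => (I.map d).sum ^ 2 + 2 * (I.map d).sum * d y)
        (Set.Ioo 0 1) := (integrable_const _).add (hi.const_mul _)
    rw [integral_add hi3 hi2, integral_add (integrable_const _) (hi.const_mul _), integral_const_mul, h0]
    simp

theorem integral_abs_sum_map_le {d : ℝ → ℝ} (hd : Measurable d)
    (hb : ∀ y ∈ Set.Ioo (0 : ℝ) 1, |d y| ≤ 1) (h0 : ∫ y in Set.Ioo (0 : ℝ) 1, d y = 0) {n : ℕ}
    (hn : 0 < n) :
    ∫ x, |((List.ofFn x).map d).sum| ∂uniformItems n ≤ √n := by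
  have hn0 : (0 : ℝ) < √n := Real.sqrt_pos.2 (by exact_mod_cast hn)
  have hs : √n ^ 2 = (n : ℝ) := Real.sq_sqrt n.cast_nonneg
  have hv : ∫ y in Set.Ioo (0 : ℝ) 1, d y ^ 2 ≤ 1 := by
    have h := norm_integral_le_of_norm_le_const (μ := volume.restrict (Set.Ioo (0 : ℝ) 1)) (C := 1)
      (f := fun y => d y ^ 2) ((ae_restrict_mem measurableSet_Ioo).mono fun y hy => by
        rw [norm_pow]; exact pow_le_one₀ (norm_nonneg _) (hb y hy))
    exact (le_abs_self _).trans (by simpa using h)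
  -- The pointwise bound is `|S| ≤ (S² + n)/(2√n)`, and `E[S²] ≤ n`.
  have h := integral_mono (integrable_sum_map hd hb n).abs
    (((integrable_sum_map_sq hd hb n).add (integrable_const (n : ℝ))).div_const (2 * √n))
    (fun x => by
      simp only [Pi.add_apply]
      rw [le_div_iff₀ (by positivity), ← sq_abs]
      nlinarith [sq_nonneg (|((List.ofFn x).map d).sum| - √n)])
  refine h.trans ?_
  simp only [Pi.add_apply]
  rw [integral_div, integral_add (integrable_sum_map_sq hd hb n) (integrable_const _),
    integral_sum_map_sq hd hb h0, div_le_iff₀ (by positivity)]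
  simp only [integral_const, probReal_univ, one_smul]
  nlinarith [(Nat.cast_nonneg n : (0 : ℝ) ≤ n)]

/-! ### Pairing complementary cells -/

/-- The cell of an item size when `(0,1)` is divided into `2p+1` cells of equal length. -/
noncomputable def cell (p : ℕ) (y : ℝ) : ℕ := ⌊(2 * p + 1) * y⌋₊

/-- The indicator function of a cell. -/
noncomputable def cellIndicator (p j : ℕ) (y : ℝ) : ℝ := if cell p y = j then 1 else 0

theorem measurable_cellIndicator (p j : ℕ) : Measurable (cellIndicator p j) :=
  Measurable.ite (measurableSet_eq_fun
    (Nat.measurable_floor.comp (measurable_id.const_mul _)) measurable_const)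
    measurable_const measurable_const

theorem cellIndicator_mem (p j : ℕ) (y : ℝ) : cellIndicator p j y ∈ Set.Icc (0 : ℝ) 1 := by
  unfold cellIndicator; split_ifs <;> simp

theorem abs_cellIndicator_le (p j : ℕ) (y : ℝ) : |cellIndicator p j y| ≤ 1 := by
  rw [abs_of_nonneg (cellIndicator_mem p j y).1]
  exact (cellIndicator_mem p j y).2

theorem integral_cellIndicator {p j : ℕ} (h1 : 1 ≤ j) (h2 : j ≤ 2 * p) :
    ∫ y in Set.Ioo (0 : ℝ) 1, cellIndicator p j y = 1 / (2 * p + 1) := by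
  have hL : (0 : ℝ) < 2 * p + 1 := by positivity
  have hj1 : (1 : ℝ) ≤ j := by exact_mod_cast h1
  have hj2 : (j : ℝ) ≤ 2 * p := by exact_mod_cast h2
  have h : cellIndicator p j = (Set.Ico ((j : ℝ) / (2 * p + 1)) ((j + 1) / (2 * p + 1))).indicator
      fun _ => 1 := by
    ext y
    classical
    rw [cellIndicator, Set.indicator_apply]
    refine if_congr ?_ rfl rfl
    rw [cell, Nat.floor_eq_iff' (by omega), Set.mem_Ico, div_le_iff₀ hL, lt_div_iff₀ hL,
      mul_comm y]
  have hsub : Set.Ico ((j : ℝ) / (2 * p + 1)) ((j + 1) / (2 * p + 1)) ⊆ Set.Ioo 0 1 := by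
    intro y hy
    refine ⟨lt_of_lt_of_le (by positivity) hy.1, hy.2.trans_le ?_⟩
    rw [div_le_one hL]; linarith
  rw [h, setIntegral_indicator measurableSet_Ico, Set.inter_eq_self_of_subset_right hsub]
  simp only [integral_const, MeasurableSet.univ, measureReal_restrict_apply, Set.univ_inter,
    smul_eq_mul, mul_one, Real.volume_real_Ico]
  rw [← sub_div, add_sub_cancel_left, max_eq_left (by positivity)]

theorem card_cell_eq {n : ℕ} (p j : ℕ) (x : Fin n → ℝ) :
    ((Finset.univ.filter fun m => cell p (x m) = j).card : ℝ) =
      ((List.ofFn x).map (cellIndicator p j)).sum := by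
  rw [List.map_ofFn, List.sum_ofFn, Finset.natCast_card_filter]
  rfl

/-- Cell indices `i + 1` and `2p - i` add up to `2p + 1`, so one item from each has total size at
least `1`. Cell `0` stays unpaired, which is why the number of cells is odd. -/
theorem sum_min_card_cell_le_opt {n : ℕ} (p : ℕ) {x : Fin n → ℝ} (hx : ∀ i, 0 ≤ x i) :
    ∑ i : Fin p, min (Finset.univ.filter fun m => cell p (x m) = i + 1).card
      (Finset.univ.filter fun m => cell p (x m) = 2 * p - i).card ≤ opt x := by
  let A : ℕ → Finset (Fin n) := fun j => Finset.univ.filter fun m => cell p (x m) = j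
  have hA : ∀ j (a : A j), cell p (x a) = j := fun j a => (Finset.mem_filter.1 a.2).2
  -- Under fixed enumerations, `u` and `v` take items of equal rank from the two cells, as long as
  -- both last.
  let u : (Σ i : Fin p, Fin (min (A (i + 1)).card (A (2 * p - i)).card)) → Fin n := fun a =>
    (A (a.1 + 1)).equivFin.symm (Fin.castLE (min_le_left _ _) a.2)
  let v : (Σ i : Fin p, Fin (min (A (i + 1)).card (A (2 * p - i)).card)) → Fin n := fun a =>
    (A (2 * p - a.1)).equivFin.symm (Fin.castLE (min_le_right _ _) a.2)
  have hu : ∀ a, cell p (x (u a)) = a.1 + 1 := fun a => hA _ _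
  have hv : ∀ a, cell p (x (v a)) = 2 * p - a.1 := fun a => hA _ _
  have hL : (0 : ℝ) < 2 * p + 1 := by positivity
  have h := card_le_opt_of_matching (x := x) (u := u) (v := v) ?_ ?_ ?_ ?_
  · simpa using h
  · rintro ⟨i, r⟩ ⟨i', r'⟩ he
    have h1 := hu ⟨i, r⟩
    have h2 := hu ⟨i', r'⟩
    rw [he, h2] at h1
    obtain rfl : i = i' := Fin.ext (by simpa using h1.symm)
    simpa [u] using he
  · rintro ⟨i, r⟩ ⟨i', r'⟩ he
    have h1 := hv ⟨i, r⟩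
    have h2 := hv ⟨i', r'⟩
    rw [he, h2] at h1
    obtain rfl : i = i' := Fin.ext (by simp only at h1; omega)
    simpa [v] using he
  · intro a b he
    have h1 := hu a
    have h2 := hv b
    rw [he, h2] at h1
    omega
  · intro a
    have h1 := Nat.floor_le (mul_nonneg hL.le (hx (u a)))
    have h2 := Nat.floor_le (mul_nonneg hL.le (hx (v a)))
    have h3 : ⌊(2 * p + 1) * x (u a)⌋₊ + ⌊(2 * p + 1) * x (v a)⌋₊ = 2 * p + 1 := by
      have h4 := hu a
      have h5 := hv a
      unfold cell at h4 h5
      omega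
    have h4 : (⌊(2 * p + 1) * x (u a)⌋₊ : ℝ) + ⌊(2 * p + 1) * x (v a)⌋₊ = 2 * p + 1 := by
      exact_mod_cast h3
    nlinarith

/-! ### The expected optimum is asymptotic to `n/2` -/

theorem integral_opt_le (n : ℕ) : ∫ x, (opt x : ℝ) ∂uniformItems n ≤ n / 2 := by
  have hb : ∀ y ∈ Set.Ioo (0 : ℝ) 1, |(id y : ℝ)| ≤ 1 := fun y hy =>
    abs_le.2 ⟨by simp only [id]; linarith [hy.1], hy.2.le⟩
  have h1 : ∫ y in Set.Ioo (0 : ℝ) 1, id y = 1 / 2 := by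
    rw [← integral_Ioc_eq_integral_Ioo, ← intervalIntegral.integral_of_le zero_le_one]
    norm_num
  have h := integral_mono_ae (integrable_opt n) (integrable_sum_map measurable_id hb n) (by
    filter_upwards [ae_uniformItems n] with x hx
    simpa [List.sum_ofFn] using opt_le_sum fun i => (hx i).1.le)
  rw [integral_sum_map measurable_id hb, h1] at h
  linarith

theorem half_sub_abs_eq_min (a b : ℝ) : (a + b - |a - b|) / 2 = min a b := by
  rcases le_total a b with h | h
  · rw [abs_of_nonpos (by linarith), min_eq_left h]; ring
  · rw [abs_of_nonneg (by linarith), min_eq_right h]; ring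

/-- Write `min a b = (a + b - |a - b|)/2` for the two cell counts. Each has mean `n/(2p+1)`, and
their difference is a centred sum, so its mean absolute value is at most `√n`. -/
theorem le_integral_opt (p : ℕ) {n : ℕ} (hn : 0 < n) :
    p / (2 * p + 1) * n - p * √n / 2 ≤ ∫ x, (opt x : ℝ) ∂uniformItems n := by
  let S : (ℝ → ℝ) → (Fin n → ℝ) → ℝ := fun d x => ((List.ofFn x).map d).sum
  let D : ℕ → ℝ → ℝ := fun i y => cellIndicator p (i + 1) y - cellIndicator p (2 * p - i) y
  have hDm : ∀ i, Measurable (D i) := fun i =>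
    (measurable_cellIndicator _ _).sub (measurable_cellIndicator _ _)
  have hDb : ∀ i, ∀ y ∈ Set.Ioo (0 : ℝ) 1, |D i y| ≤ 1 := fun i y _ => by
    have h1 := cellIndicator_mem p (i + 1) y
    have h2 := cellIndicator_mem p (2 * p - i) y
    exact abs_le.2 ⟨by simp only [D]; linarith [h1.1, h2.2], by simp only [D]; linarith [h1.2, h2.1]⟩
  have hcb : ∀ j, ∀ y ∈ Set.Ioo (0 : ℝ) 1, |cellIndicator p j y| ≤ 1 := fun j y _ =>
    abs_cellIndicator_le p j y
  have hci : ∀ j, Integrable (S (cellIndicator p j)) (uniformItems n) := fun j =>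
    integrable_sum_map (measurable_cellIndicator p j) (hcb j) n
  have hDi : ∀ i, Integrable (fun x => |S (D i) x|) (uniformItems n) := fun i =>
    (integrable_sum_map (hDm i) (hDb i) n).abs
  have hSD : ∀ i x, S (D i) x = S (cellIndicator p (i + 1)) x - S (cellIndicator p (2 * p - i)) x :=
    fun i x => by
      simp only [S, D, List.map_ofFn, List.sum_ofFn, Function.comp_apply, Finset.sum_sub_distrib]
  let F : Fin p → (Fin n → ℝ) → ℝ := fun i x => (S (cellIndicator p (i + 1)) x +
    S (cellIndicator p (2 * p - i)) x - |S (D i) x|) / 2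
  have hFi : ∀ i, Integrable (F i) (uniformItems n) := fun i =>
    (((hci _).add (hci _)).sub (hDi i)).div_const 2
  have hF : ∀ i, n / (2 * p + 1) - √n / 2 ≤ ∫ x, F i x ∂uniformItems n := fun i => by
    have hi := i.2
    have h1 : ∫ y in Set.Ioo (0 : ℝ) 1, cellIndicator p (i + 1) y = 1 / (2 * p + 1) :=
      integral_cellIndicator (by omega) (by omega)
    have h2 : ∫ y in Set.Ioo (0 : ℝ) 1, cellIndicator p (2 * p - i) y = 1 / (2 * p + 1) :=
      integral_cellIndicator (by omega) (by omega)
    have h0 : ∫ y in Set.Ioo (0 : ℝ) 1, D i y = 0 := by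
      simp only [D]
      rw [integral_sub (integrableOn_of_abs_le_one (measurable_cellIndicator _ _) (hcb _))
        (integrableOn_of_abs_le_one (measurable_cellIndicator _ _) (hcb _)), h1, h2, sub_self]
    have h3 : ∫ x, |S (D i) x| ∂uniformItems n ≤ √n := integral_abs_sum_map_le (hDm i) (hDb i) h0 hn
    have h4 : ∀ j, ∫ x, S (cellIndicator p j) x ∂uniformItems n =
        n * ∫ y in Set.Ioo (0 : ℝ) 1, cellIndicator p j y := fun j =>
      integral_sum_map (measurable_cellIndicator p j) (hcb j) n
    have h5 : Integrable (fun x => S (cellIndicator p (i + 1)) x +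
        S (cellIndicator p (2 * p - i)) x) (uniformItems n) := (hci _).add (hci _)
    simp only [F]
    rw [integral_div, integral_sub h5 (hDi i), integral_add (hci _) (hci _), h4,
      h4, h1, h2]
    have : (n : ℝ) / (2 * p + 1) = n * (1 / (2 * p + 1)) := by ring
    linarith
  have h := integral_mono_ae (integrable_finsetSum Finset.univ fun i _ => hFi i) (integrable_opt n)
    (by
      filter_upwards [ae_uniformItems n] with x hx
      have h : ((∑ i : Fin p, min (Finset.univ.filter fun m => cell p (x m) = i + 1).card
          (Finset.univ.filter fun m => cell p (x m) = 2 * p - i).card : ℕ) : ℝ) ≤ opt x :=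
        Nat.cast_le.2 (sum_min_card_cell_le_opt p fun i => (hx i).1.le)
      refine le_trans (le_of_eq ?_) h
      rw [Nat.cast_sum]
      refine Finset.sum_congr rfl fun i _ => ?_
      rw [Nat.cast_min, card_cell_eq, card_cell_eq]
      simp only [F, hSD]
      exact half_sub_abs_eq_min _ _)
  rw [integral_finsetSum _ fun i _ => hFi i] at h
  refine le_trans ?_ h
  refine le_trans (le_of_eq ?_) (Finset.sum_le_sum fun i _ => hF i)
  simp
  ring

theorem tendsto_integral_opt_div :
    Tendsto (fun n : ℕ => (∫ x, (opt x : ℝ) ∂uniformItems n) / n) atTop (𝓝 (1 / 2)) := by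
  refine tendsto_order.2 ⟨fun a ha => ?_, fun a ha => ?_⟩
  · have hp : Tendsto (fun p : ℕ => (1 - 1 / ((2 * p + 1 : ℕ) : ℝ)) / 2) atTop (𝓝 (1 / 2)) := by
      have h : Tendsto (fun p : ℕ => 2 * p + 1) atTop atTop :=
        tendsto_atTop_mono (fun p => by simp only [id]; omega) tendsto_id
      simpa using (((tendsto_one_div_atTop_nhds_zero_nat (𝕜 := ℝ)).comp h).const_sub 1).div_const 2
    -- The number of cells is fixed before `n` grows, so the error `p√n/2` is negligible against
    -- `n`.
    obtain ⟨p, hp⟩ := (hp.eventually (lt_mem_nhds ha)).exists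
    have hpe : (1 - 1 / ((2 * p + 1 : ℕ) : ℝ)) / 2 = p / (2 * p + 1) := by
      push_cast; field_simp; ring
    rw [hpe] at hp
    have hlim : Tendsto (fun n : ℕ => (p : ℝ) / (2 * p + 1) - p / 2 * (1 / √n)) atTop
        (𝓝 (p / (2 * p + 1))) := by
      have h : Tendsto (fun n : ℕ => 1 / √(n : ℝ)) atTop (𝓝 0) := by
        simp only [one_div]
        exact (Real.tendsto_sqrt_atTop.comp tendsto_natCast_atTop_atTop).inv_tendsto_atTop
      simpa using (h.const_mul ((p : ℝ) / 2)).const_sub ((p : ℝ) / (2 * p + 1))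
    filter_upwards [hlim.eventually (lt_mem_nhds hp), eventually_gt_atTop 0] with n h hn
    refine h.trans_le ?_
    have hn0 : (0 : ℝ) < n := by exact_mod_cast hn
    rw [le_div_iff₀ hn0]
    refine le_trans (le_of_eq ?_) (le_integral_opt p hn)
    have hs : 1 / √(n : ℝ) * n = √n := by
      rw [one_div_mul_eq_div, Real.div_sqrt]
    rw [sub_mul, mul_assoc (p / 2 : ℝ), hs]
    ring
  · filter_upwards [eventually_gt_atTop 0] with n hn
    have hn0 : (0 : ℝ) < n := by exact_mod_cast hn
    refine lt_of_le_of_lt ?_ ha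
    rw [div_le_iff₀ hn0]
    linarith [integral_opt_le n]

theorem hasExpectedRatio_covered {k t : ℕ} {c : ℝ → ℕ} (hc : IsHarmonicMap k t c) :
    HasExpectedRatio (covered c) (2 * coverRate k) := by
  refine ⟨integrable_covered hc.measurable, integrable_opt, ?_⟩
  have h := (tendsto_integral_covered_div hc).div tendsto_integral_opt_div (by norm_num)
  rw [show 2 * coverRate k = coverRate k / (1 / 2) by ring]
  refine h.congr' ?_
  filter_upwards [eventually_gt_atTop 0] with n hn
  exact div_div_div_cancel_right₀ (by exact_mod_cast hn.ne') _ _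

end BinCovering

theorem mainTheorem1 :
    -- the ratio of Dual Harmonic exists for every `k ≥ 2`; its value at `2` and its limit
    (∃ R : ℕ → ℝ,
      (∀ k : ℕ, 2 ≤ k → BinCovering.HasExpectedRatio (BinCovering.DH k) (R k)) ∧
      R 2 = 1 / 2 + 1 / (Real.exp 1 ^ 2 - Real.exp 1) ∧
      Tendsto R atTop (𝓝 ((12 - Real.pi ^ 2) / 3))) ∧
    -- the ratio of Dual Next-Fit
    BinCovering.HasExpectedRatio BinCovering.DNF (2 / Real.exp 1) ∧
    -- numerical values, rounded to four decimal places
    |1 / 2 + 1 / (Real.exp 1 ^ 2 - Real.exp 1) - 0.7141| < 0.00005 ∧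
    |(12 - Real.pi ^ 2) / 3 - 0.7101| < 0.00005 ∧
    -- both are worse than Dual Next-Fit
    1 / 2 + 1 / (Real.exp 1 ^ 2 - Real.exp 1) < 2 / Real.exp 1 ∧
    (12 - Real.pi ^ 2) / 3 < 2 / Real.exp 1 := by
  have h2 := BinCovering.abs_ratio_two_sub_lt
  have h3 := BinCovering.abs_ratio_limit_sub_lt
  have he := BinCovering.lt_two_div_exp_one
  refine ⟨⟨fun k => 2 * BinCovering.coverRate k, fun k hk =>
    BinCovering.hasExpectedRatio_covered (BinCovering.isHarmonicMap_harmonicType hk), ?_, ?_⟩,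
    ?_, h2, h3, ?_, ?_⟩
  · change 2 * BinCovering.coverRate 2 = _
    rw [BinCovering.coverRate_two]
    ring
  · refine (BinCovering.tendsto_coverRate.const_mul 2).trans_eq ?_
    congr 1
    ring
  · have h := BinCovering.hasExpectedRatio_covered BinCovering.isHarmonicMap_const
    rw [BinCovering.coverRate_one, mul_one_div] at h
    exact h
  · have := (abs_lt.1 h2).2
    norm_num at *
    linarith
  · have := (abs_lt.1 h3).2
    norm_num at *
    linarith
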